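/- Consider second-order logic over a signature with a single sort and the function symbols $0$, $1$, $+$ (with equality), and let $T$ be Presburger arithmetic, i.e. the theory of all first-order sentences over this signature that are true in $(\mathbb{N}; 0, 1, +)$. A sentence $\phi$ is $T$-satisfiable if some structure satisfies $\phi$ and all the sentences of $T$. The $T$-satisfiability problem is undecidable for sentences of the form $$(\exists x_1 \cdots \exists x_m)\,(\exists R_1 \cdots \exists R_k)\,(\forall y_1 \cdots \forall y_n)\;\psi,$$ where the $x_i$ and $y_j$ are first-order variables, the $R_i$ are relation variables of arbitrary positive arities, $m,k,n\ge 0$, and $\psi$ is quantifier-free. That is, there is no algorithm which, given (the code of) any sentence of this form, halts and correctly answers whether the sentence is $T$-satisfiable. -/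

import Mathlib

open FirstOrder FirstOrder.Language

/-- The theory of Presburger arithmetic: all first-order sentences over the signature `(0, 1, +)`
that are true in the natural numbers. -/
def presburgerTheory : presburger.Theory := presburger.completeTheory ℕ

/-- A relation variable over the single sort: a name together with an arity, which is positive
(the arity is `arityPred + 1`). -/
structure RelVar where
  index : ℕ
  arityPred : ℕ
  deriving DecidableEq

/-- The (positive) arity of a relation variable. -/
def RelVar.arity (R : RelVar) : ℕ := R.arityPred + 1

/-- Formulas of second-order logic over the one-sorted Presburger signature `(0, 1, +)`, with
first-order variables named by natural numbers, and with quantification over elements and over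
relations. (The signature has no relation symbols, and function variables are left out: the
sentences considered here do not quantify over functions, so they contain none.) -/
inductive SOFormula : Type
  | falsum : SOFormula
  | imp (φ ψ : SOFormula) : SOFormula
  | eq (t₁ t₂ : presburger.Term ℕ) : SOFormula
  | rel (R : RelVar) (ts : Fin R.arity → presburger.Term ℕ) : SOFormula
  | ex (x : ℕ) (φ : SOFormula) : SOFormula
  | exRel (R : RelVar) (φ : SOFormula) : SOFormula

namespace SOFormula

/-- Negation, as an abbreviation. -/
def neg (φ : SOFormula) : SOFormula := imp φ falsum

/-- First-order universal quantification, as an abbreviation. -/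
def all (x : ℕ) (φ : SOFormula) : SOFormula := neg (ex x (neg φ))

/-- The formula `(∃ x₁) ⋯ (∃ xₙ) φ`. -/
def exs (xs : List ℕ) (φ : SOFormula) : SOFormula := xs.foldr ex φ

/-- The formula `(∃ R₁) ⋯ (∃ Rₙ) φ`. -/
def exRels (Rs : List RelVar) (φ : SOFormula) : SOFormula := Rs.foldr exRel φ

/-- The formula `(∀ y₁) ⋯ (∀ yₙ) φ`. -/
def alls (ys : List ℕ) (φ : SOFormula) : SOFormula := ys.foldr all φ

/-- The formula has no quantifiers. -/
def IsQuantifierFree : SOFormula → Prop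
  | falsum => True
  | imp φ ψ => φ.IsQuantifierFree ∧ ψ.IsQuantifierFree
  | eq _ _ => True
  | rel _ _ => True
  | ex _ _ => False
  | exRel _ _ => False

/-- The first-order variables that occur free. -/
def freeVars : SOFormula → Set ℕ
  | falsum => ∅
  | imp φ ψ => φ.freeVars ∪ ψ.freeVars
  | eq t₁ t₂ => {x | x ∈ t₁.varFinset ∨ x ∈ t₂.varFinset}
  | rel _ ts => {x | ∃ i, x ∈ (ts i).varFinset}
  | ex x φ => φ.freeVars \ {x}
  | exRel _ φ => φ.freeVars

/-- The relation variables that occur free. -/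
def freeRelVars : SOFormula → Set RelVar
  | falsum => ∅
  | imp φ ψ => φ.freeRelVars ∪ ψ.freeRelVars
  | eq _ _ => ∅
  | rel R _ => {R}
  | ex _ φ => φ.freeRelVars
  | exRel R φ => φ.freeRelVars \ {R}

/-- A sentence: every variable is quantified. -/
def IsSentence (φ : SOFormula) : Prop := φ.freeVars = ∅ ∧ φ.freeRelVars = ∅

/-- Sentences of the form `(∃ x₁ ⋯ xₘ) (∃ R₁ ⋯ Rₖ) (∀ y₁ ⋯ yₙ) ψ` with `ψ` quantifier-free. -/
def existsRelForall : Set SOFormula :=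
  {φ | φ.IsSentence ∧ ∃ (xs : List ℕ) (Rs : List RelVar) (ys : List ℕ) (ψ : SOFormula),
    ψ.IsQuantifierFree ∧ φ = exs xs (exRels Rs (alls ys ψ))}

/-- Satisfaction in a structure `M`, under an interpretation `v` of the first-order variables and
an interpretation `ρ` of the relation variables. -/
def Sat {M : Type*} [presburger.Structure M] :
    SOFormula → (ℕ → M) → ((R : RelVar) → (Fin R.arity → M) → Prop) → Prop
  | falsum, _, _ => False
  | imp φ ψ, v, ρ => φ.Sat v ρ → ψ.Sat v ρ
  | eq t₁ t₂, v, _ => t₁.realize v = t₂.realize v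
  | rel R ts, v, ρ => ρ R (fun i => (ts i).realize v)
  | ex x φ, v, ρ => ∃ a : M, φ.Sat (Function.update v x a) ρ
  | exRel R φ, v, ρ => ∃ r : (Fin R.arity → M) → Prop, φ.Sat v (Function.update ρ R r)

/-- Satisfiability modulo a theory `T`: some structure (with an interpretation of the variables)
satisfies the formula and all the sentences of `T`. -/
def SatisfiableModulo (T : presburger.Theory) (φ : SOFormula) : Prop :=
  ∃ (M : Type) (_ : presburger.Structure M), M ⊨ T ∧
    ∃ (v : ℕ → M) (ρ : (R : RelVar) → (Fin R.arity → M) → Prop), φ.Sat v ρ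

end SOFormula

section Coding

/-- Code of a term headed by a function symbol, from the codes of its arguments. -/
def funcCode : {n : ℕ} → presburgerFunc n → (Fin n → ℕ) → ℕ
  | _, .zero, _ => Nat.pair 1 0
  | _, .one, _ => Nat.pair 2 0
  | _, .add, a => Nat.pair 3 (Nat.pair (a 0) (a 1))

/-- Gödel numbering of terms. -/
def termCode : presburger.Term ℕ → ℕ
  | .var n => Nat.pair 0 n
  | .func f ts => funcCode f (fun i => termCode (ts i))

/-- Gödel numbering of relation variables. -/
def RelVar.code (R : RelVar) : ℕ := Nat.pair R.index R.arityPred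

/-- Gödel numbering of formulas; lists of numbers are coded by Mathlib's standard (primitive
recursive) numbering of `List ℕ`. -/
def SOFormula.code : SOFormula → ℕ
  | falsum => Nat.pair 0 0
  | imp φ ψ => Nat.pair 1 (Nat.pair φ.code ψ.code)
  | eq t₁ t₂ => Nat.pair 2 (Nat.pair (termCode t₁) (termCode t₂))
  | rel R ts => Nat.pair 3 (Nat.pair R.code
      (Encodable.encode (List.ofFn fun i => termCode (ts i))))
  | ex x φ => Nat.pair 4 (Nat.pair x φ.code)
  | exRel R φ => Nat.pair 5 (Nat.pair R.code φ.code)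

theorem pair_zero_ne_funcCode {n : ℕ} (f : presburgerFunc n) (a : Fin n → ℕ) (k : ℕ) :
    Nat.pair 0 k ≠ funcCode f a := by
  cases f <;> simp [funcCode, Nat.pair_eq_pair]

theorem termCode_injective : Function.Injective termCode := by
  intro s
  induction s with
  | var n =>
    intro t h
    cases t with
    | var m => simpa [termCode, Nat.pair_eq_pair] using h
    | func g us => exact absurd h (pair_zero_ne_funcCode g _ n)
  | @func l f ts ih =>
    intro t h
    cases t with
    | var m => exact absurd h.symm (pair_zero_ne_funcCode f _ m)
    | @func k g us =>
      change presburgerFunc l at f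
      change presburgerFunc k at g
      cases f <;> cases g <;> simp only [termCode, funcCode, Nat.pair_eq_pair] at h <;>
        first
        | omega
        | (congr 1; exact Subsingleton.elim _ _)
        | (congr 1
           funext i
           fin_cases i
           · exact ih 0 h.2.1
           · exact ih 1 h.2.2)

theorem RelVar.code_injective : Function.Injective RelVar.code := by
  rintro ⟨i, n⟩ ⟨j, m⟩ h
  simpa [RelVar.code, Nat.pair_eq_pair] using h

/-- Distinct formulas have distinct codes. -/
theorem SOFormula.code_injective : Function.Injective SOFormula.code := by
  intro φ
  induction φ with
  | falsum =>
    intro χ h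
    cases χ <;> simp [SOFormula.code, Nat.pair_eq_pair] at h ⊢
  | imp φ ψ ih₁ ih₂ =>
    intro χ h
    cases χ <;> simp [SOFormula.code, Nat.pair_eq_pair] at h ⊢
    exact ⟨ih₁ h.1, ih₂ h.2⟩
  | eq t₁ t₂ =>
    intro χ h
    cases χ <;> simp [SOFormula.code, Nat.pair_eq_pair] at h ⊢
    exact ⟨termCode_injective h.1, termCode_injective h.2⟩
  | rel R ts =>
    intro χ h
    cases χ <;> simp only [SOFormula.code, Nat.pair_eq_pair] at h <;> try omega
    rename_i S us
    obtain ⟨-, h₁, h₂⟩ := h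
    obtain rfl := RelVar.code_injective h₁
    have h₃ := List.ofFn_injective (Encodable.encode_injective h₂)
    congr 1
    funext i
    exact termCode_injective (congrFun h₃ i)
  | ex x φ ih =>
    intro χ h
    cases χ <;> simp [SOFormula.code, Nat.pair_eq_pair] at h ⊢
    exact ⟨h.1, ih h.2⟩
  | exRel R φ ih =>
    intro χ h
    cases χ <;> simp [SOFormula.code, Nat.pair_eq_pair] at h ⊢
    exact ⟨RelVar.code_injective h.1, ih h.2⟩

end Coding

/-- The problem "given a formula from the class `S`, does it have the property `P`?" is
algorithmically decidable: some partial recursive function, on the code of every formula in `S`,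
halts and returns the correct answer (its behaviour on other inputs is not restricted). -/
def AlgorithmicallyDecidable (S : Set SOFormula) (P : SOFormula → Prop) : Prop :=
  ∃ f : ℕ →. Bool, Partrec f ∧ ∀ φ ∈ S, ∃ b ∈ f φ.code, (b = true ↔ P φ)

/-! The halting problem reduces to the complement of the satisfiability problem. For a code `c` of a
partial recursive function, universal Horn clauses over relation variables describe multiplication,
pairing and the graph of each subcode of `c`. The true graphs satisfy the clauses
(`sat_graphClauses_intended`), and any relations on `ℕ` that satisfy them contain the true graphs
(`bin_graph_of_sat`). A further clause forbidding any value at `n` is therefore consistent with them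
over `ℕ` exactly when `c` is undefined at `n`.

Passing from models of Presburger arithmetic to `ℕ` costs nothing (`satisfiableModulo_iff_nat`): `ℕ`
is a model and embeds in every model, and universal sentences survive pulling the relations back
along the embedding.

With `c` a fixed universal code, only the numeral for `n` varies, so the reduction is plainly
computable. -/

open Nat.Partrec (Code)

namespace SOFormula

/-! ### Conjunctions, quantifier blocks, and dependence on the free variables -/

/-- Conjunction, as an abbreviation. -/
def conj (φ ψ : SOFormula) : SOFormula := neg (imp φ (neg ψ))

section Sat

variable {M : Type*} [presburger.Structure M]

theorem sat_conj {φ ψ : SOFormula} {v : ℕ → M} {ρ : (R : RelVar) → (Fin R.arity → M) → Prop} :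
    (conj φ ψ).Sat v ρ ↔ φ.Sat v ρ ∧ ψ.Sat v ρ := by
  simp only [conj, neg, Sat]
  tauto

theorem sat_all {x : ℕ} {φ : SOFormula} {v : ℕ → M}
    {ρ : (R : RelVar) → (Fin R.arity → M) → Prop} :
    (all x φ).Sat v ρ ↔ ∀ a : M, φ.Sat (Function.update v x a) ρ := by
  simp only [all, neg, Sat, imp_false, not_exists, not_not]

theorem sat_alls {ys : List ℕ} {φ : SOFormula} {v : ℕ → M}
    {ρ : (R : RelVar) → (Fin R.arity → M) → Prop} :
    (alls ys φ).Sat v ρ ↔ ∀ w : ℕ → M, (∀ x ∉ ys, w x = v x) → φ.Sat w ρ := by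
  induction ys generalizing v with
  | nil =>
    refine ⟨fun h w hw => ?_, fun h => h v fun _ _ => rfl⟩
    rwa [show w = v from funext fun x => hw x List.not_mem_nil]
  | cons y ys ih =>
    change (all y (alls ys φ)).Sat v ρ ↔ _
    rw [sat_all]
    refine ⟨fun h w hw => (ih.1 (h (w y))) w fun x hx => ?_,
      fun h a => ih.2 fun w hw => h w fun x hx => ?_⟩
    · by_cases hxy : x = y
      · subst hxy; simp
      · simp [hxy, hw x (by simp [hxy, hx])]
    · simp only [List.mem_cons, not_or] at hx
      simp [hw x hx.2, hx.1]

theorem sat_exRels {Rs : List RelVar} {φ : SOFormula} {v : ℕ → M}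
    {ρ : (R : RelVar) → (Fin R.arity → M) → Prop} :
    (exRels Rs φ).Sat v ρ ↔
      ∃ σ : (R : RelVar) → (Fin R.arity → M) → Prop, (∀ R ∉ Rs, σ R = ρ R) ∧ φ.Sat v σ := by
  induction Rs generalizing ρ with
  | nil =>
    refine ⟨fun h => ⟨ρ, fun _ _ => rfl, h⟩, fun ⟨σ, hσ, h⟩ => ?_⟩
    rwa [show σ = ρ from funext fun R => hσ R List.not_mem_nil] at h
  | cons S Rs ih =>
    change (∃ r, (exRels Rs φ).Sat v (Function.update ρ S r)) ↔ _
    constructor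
    · rintro ⟨r, h⟩
      obtain ⟨σ, hσ, h⟩ := ih.1 h
      refine ⟨σ, fun R hR => ?_, h⟩
      simp only [List.mem_cons, not_or] at hR
      simp [hσ R hR.2, hR.1]
    · rintro ⟨σ, hσ, h⟩
      refine ⟨σ S, ih.2 ⟨σ, fun R hR => ?_, h⟩⟩
      by_cases hRS : R = S
      · subst hRS; simp
      · simp [hRS, hσ R (by simp [hRS, hR])]

theorem realize_term_congr {t : presburger.Term ℕ} {v w : ℕ → M}
    (h : ∀ x ∈ t.varFinset, v x = w x) : t.realize v = t.realize w := by
  induction t with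
  | var x => exact h x (by simp [Term.varFinset])
  | func f ts ih =>
    simp only [Term.realize]
    congr 1
    funext i
    refine ih i fun x hx => h x ?_
    simp only [Term.varFinset, Finset.mem_biUnion, Finset.mem_univ, true_and]
    exact ⟨i, hx⟩

theorem IsQuantifierFree.sat_congr {φ : SOFormula} (hφ : φ.IsQuantifierFree) {v w : ℕ → M}
    {ρ : (R : RelVar) → (Fin R.arity → M) → Prop} (h : ∀ x ∈ φ.freeVars, v x = w x) :
    φ.Sat v ρ ↔ φ.Sat w ρ := by
  induction φ with
  | falsum => rfl
  | imp φ ψ ih₁ ih₂ =>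
    exact imp_congr (ih₁ hφ.1 fun x hx => h x (Or.inl hx)) (ih₂ hφ.2 fun x hx => h x (Or.inr hx))
  | eq t₁ t₂ =>
    simp only [Sat]
    rw [realize_term_congr fun x hx => h x (Or.inl hx),
      realize_term_congr fun x hx => h x (Or.inr hx)]
  | rel R ts =>
    simp only [Sat]
    rw [show (fun i => (ts i).realize v) = fun i => (ts i).realize w from
      funext fun i => realize_term_congr fun x hx => h x ⟨i, hx⟩]
  | ex x φ => exact hφ.elim
  | exRel R φ => exact hφ.elim

/-- Pulled-back relations preserve relational atoms by construction; injectivity of `e` is what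
makes equations transfer in both directions. -/
theorem IsQuantifierFree.sat_embedding {N : Type*} [presburger.Structure N] (e : N ↪[presburger] M)
    {φ : SOFormula} (hφ : φ.IsQuantifierFree) {v : ℕ → N}
    {ρ : (R : RelVar) → (Fin R.arity → M) → Prop} :
    φ.Sat (e ∘ v) ρ ↔ φ.Sat v fun R a => ρ R (e ∘ a) := by
  induction φ with
  | falsum => rfl
  | imp φ ψ ih₁ ih₂ => exact imp_congr (ih₁ hφ.1) (ih₂ hφ.2)
  | eq t₁ t₂ => simp only [Sat, HomClass.realize_term, e.injective.eq_iff]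
  | rel R ts =>
    exact iff_of_eq (congrArg (ρ R) (funext fun i => HomClass.realize_term e))
  | ex x φ => exact hφ.elim
  | exRel R φ => exact hφ.elim

end Sat

theorem finite_freeVars (φ : SOFormula) : φ.freeVars.Finite := by
  induction φ with
  | falsum => exact Set.finite_empty
  | imp φ ψ ih₁ ih₂ => exact ih₁.union ih₂
  | eq t₁ t₂ =>
    refine (t₁.varFinset ∪ t₂.varFinset).finite_toSet.subset fun x hx => ?_
    simpa [freeVars] using hx
  | rel R ts =>
    refine (Finset.univ.biUnion fun i => (ts i).varFinset).finite_toSet.subset fun x hx => ?_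
    simpa [freeVars] using hx
  | ex x φ ih => exact ih.subset Set.sdiff_subset
  | exRel R φ ih => exact ih

theorem finite_freeRelVars (φ : SOFormula) : φ.freeRelVars.Finite := by
  induction φ with
  | falsum => exact Set.finite_empty
  | imp φ ψ ih₁ ih₂ => exact ih₁.union ih₂
  | eq t₁ t₂ => exact Set.finite_empty
  | rel R ts => exact Set.finite_singleton R
  | ex x φ ih => exact ih
  | exRel R φ ih => exact ih.subset Set.sdiff_subset

theorem freeVars_alls (ys : List ℕ) (φ : SOFormula) :
    (alls ys φ).freeVars = φ.freeVars \ {x | x ∈ ys} := by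
  induction ys with
  | nil => simp [alls]
  | cons y ys ih =>
    change ((alls ys φ).freeVars ∪ ∅) \ {y} ∪ ∅ = _
    rw [ih]
    ext x
    simp only [Set.union_empty, Set.mem_sdiff, Set.mem_ofPred_eq, Set.mem_singleton_iff,
      List.mem_cons]
    tauto

theorem freeRelVars_alls (ys : List ℕ) (φ : SOFormula) :
    (alls ys φ).freeRelVars = φ.freeRelVars := by
  induction ys with
  | nil => rfl
  | cons y ys ih =>
    change ((alls ys φ).freeRelVars ∪ ∅) ∪ ∅ = _
    rw [ih, Set.union_empty, Set.union_empty]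

theorem freeVars_exRels (Rs : List RelVar) (φ : SOFormula) :
    (exRels Rs φ).freeVars = φ.freeVars := by
  induction Rs with
  | nil => rfl
  | cons R Rs ih => exact ih

theorem freeRelVars_exRels (Rs : List RelVar) (φ : SOFormula) :
    (exRels Rs φ).freeRelVars = φ.freeRelVars \ {R | R ∈ Rs} := by
  induction Rs with
  | nil => simp [exRels]
  | cons R Rs ih =>
    change (exRels Rs φ).freeRelVars \ {R} = _
    rw [ih]
    ext x
    simp only [Set.mem_sdiff, Set.mem_ofPred_eq, Set.mem_singleton_iff, List.mem_cons]
    tauto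

/-! ### Reduction of satisfiability modulo Presburger arithmetic to truth in `ℕ` -/

/-- An equation between closed terms is a sentence, and the theory, being complete, decides it as
`ℕ` does. -/
theorem realize_closed_eq {M : Type*} [presburger.Structure M] (hM : M ⊨ presburgerTheory)
    {s t : presburger.Term Empty} (v : Empty → M) (w : Empty → ℕ) :
    s.realize v = t.realize v ↔ s.realize w = t.realize w := by
  have : M ⊨ presburger.completeTheory ℕ := hM
  have key := realize_iff_of_model_completeTheory ℕ (L := presburger) M (s.equal t)
  simp only [Sentence.Realize, Formula.realize_equal] at key
  convert key

/-- The natural numbers embed into every model of Presburger arithmetic. -/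
noncomputable def natEmbedding {M : Type*} [presburger.Structure M] (hM : M ⊨ presburgerTheory) :
    ℕ ↪[presburger] M where
  toFun n := (n : presburger.Term Empty).realize (default : Empty → M)
  inj' m n h := by
    simpa using (realize_closed_eq hM default (default : Empty → ℕ)).1 h
  map_fun' {n} f x := by
    change presburgerFunc n at f
    have key : ∀ t : Fin n → presburger.Term Empty,
        Structure.funMap (M := M) (L := presburger) f (fun i => (t i).realize default) =
          (Term.func (L := presburger) f t).realize default := fun _ => rfl
    refine Eq.trans ?_ (key fun i => (x i : presburger.Term Empty)).symm
    -- Compatibility with a function symbol is an equation between closed terms, so it suffices to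
    -- check it in `ℕ`.
    refine (realize_closed_eq hM default (default : Empty → ℕ)).2 ?_
    simp [Term.realize]
  map_rel' r := isEmptyElim r

theorem satisfiableModulo_iff_nat {Rs : List RelVar} {ys : List ℕ} {ψ : SOFormula}
    (hψ : ψ.IsQuantifierFree) (hys : ∀ x ∈ ψ.freeVars, x ∈ ys) :
    SatisfiableModulo presburgerTheory (exRels Rs (alls ys ψ)) ↔
      ∃ ρ : (R : RelVar) → (Fin R.arity → ℕ) → Prop, ∀ v : ℕ → ℕ, ψ.Sat v ρ := by
  constructor
  · rintro ⟨M, _, hM, v, ρ, h⟩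
    obtain ⟨σ, -, h⟩ := sat_exRels.1 h
    rw [sat_alls] at h
    refine ⟨fun R a => σ R (natEmbedding hM ∘ a), fun w => (hψ.sat_embedding _).1 ?_⟩
    classical
    refine (hψ.sat_congr fun x hx => ?_).1
      -- Off `ys` the valuation must agree with `v`; this is harmless, since all free variables of
      -- `ψ` lie in `ys`.
      (h (fun x => if x ∈ ys then natEmbedding hM (w x) else v x) fun x hx => if_neg hx)
    simp [hys x hx]
  · rintro ⟨ρ, h⟩
    refine ⟨ℕ, inferInstance, ?_, fun _ => 0, ρ, sat_exRels.2 ⟨ρ, fun _ _ => rfl, ?_⟩⟩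
    · exact (inferInstance : ℕ ⊨ presburger.completeTheory ℕ)
    · exact sat_alls.2 fun w _ => h w

/-! ### Horn clauses that define the graphs of partial recursive functions -/

/-- The atomic formula for the binary relation variable with a given index. -/
def binRel (i : ℕ) (s t : presburger.Term ℕ) : SOFormula :=
  rel ⟨i, 1⟩ (![s, t] : Fin 2 → presburger.Term ℕ)

/-- The atomic formula for the ternary relation variable with a given index. -/
def terRel (i : ℕ) (s t u : presburger.Term ℕ) : SOFormula :=
  rel ⟨i, 2⟩ (![s, t, u] : Fin 3 → presburger.Term ℕ)

/-- The instance of an interpretation at a binary relation variable. -/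
def bin (ρ : (R : RelVar) → (Fin R.arity → ℕ) → Prop) (i a b : ℕ) : Prop :=
  ρ ⟨i, 1⟩ (![a, b] : Fin 2 → ℕ)

/-- The instance of an interpretation at a ternary relation variable. -/
def ter (ρ : (R : RelVar) → (Fin R.arity → ℕ) → Prop) (i a b c : ℕ) : Prop :=
  ρ ⟨i, 2⟩ (![a, b, c] : Fin 3 → ℕ)

section

variable {ρ : (R : RelVar) → (Fin R.arity → ℕ) → Prop} {v : ℕ → ℕ}

theorem sat_imp {φ ψ : SOFormula} : (imp φ ψ).Sat v ρ ↔ (φ.Sat v ρ → ψ.Sat v ρ) := Iff.rfl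

theorem sat_binRel {i : ℕ} {s t : presburger.Term ℕ} :
    (binRel i s t).Sat v ρ ↔ bin ρ i (s.realize v) (t.realize v) := by
  refine iff_of_eq (congrArg (ρ ⟨i, 1⟩) (funext fun j => ?_))
  change Fin 2 at j
  fin_cases j <;> rfl

theorem sat_terRel {i : ℕ} {s t u : presburger.Term ℕ} :
    (terRel i s t u).Sat v ρ ↔ ter ρ i (s.realize v) (t.realize v) (u.realize v) := by
  refine iff_of_eq (congrArg (ρ ⟨i, 2⟩) (funext fun j => ?_))
  change Fin 3 at j
  fin_cases j <;> rfl

end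

/-- A first-order variable as a term. -/
def tvar (n : ℕ) : presburger.Term ℕ := Term.var n

theorem realize_tvar (n : ℕ) (v : ℕ → ℕ) : (tvar n).realize v = v n := rfl

/-- Horn clauses for the graph of multiplication (the ternary relation variable `0`) and the graph
of the pairing function (the ternary relation variable `1`). -/
def pairingClauses : SOFormula :=
  conj (terRel 0 (tvar 0) 0 0) <|
  conj (imp (terRel 0 (tvar 0) (tvar 1) (tvar 2)) (terRel 0 (tvar 0) (tvar 1 + 1) (tvar 2 + tvar 0)))
  <|
  -- `Nat.pair a b` is `b * b + a` if `a < b` and `a * a + a + b` otherwise. The case conditions are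
  -- built into the terms, as `b = a + d + 1` and `a = b + d`.
  conj (imp (terRel 0 (tvar 0 + tvar 1 + 1) (tvar 0 + tvar 1 + 1) (tvar 2))
    (terRel 1 (tvar 0) (tvar 0 + tvar 1 + 1) (tvar 2 + tvar 0)))
  (imp (terRel 0 (tvar 0 + tvar 1) (tvar 0 + tvar 1) (tvar 2))
    (terRel 1 (tvar 0 + tvar 1) (tvar 0) (tvar 2 + (tvar 0 + tvar 1) + tvar 0)))

/-- The graph of the function with code `c`, as an atomic formula. -/
def graphRel (c : Code) (s t : presburger.Term ℕ) : SOFormula := binRel (Encodable.encode c) s t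

/-- Horn clauses for the graph of the function with code `c`. -/
def graphClauses : Code → SOFormula
  | .zero => graphRel .zero (tvar 0) 0
  | .succ => graphRel .succ (tvar 0) (tvar 0 + 1)
  | .left => imp (terRel 1 (tvar 0) (tvar 1) (tvar 2)) (graphRel .left (tvar 2) (tvar 0))
  | .right => imp (terRel 1 (tvar 0) (tvar 1) (tvar 2)) (graphRel .right (tvar 2) (tvar 1))
  | .pair f g =>
    conj (graphClauses f) <| conj (graphClauses g) <|
    imp (graphRel f (tvar 0) (tvar 1)) <| imp (graphRel g (tvar 0) (tvar 2)) <|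
    imp (terRel 1 (tvar 1) (tvar 2) (tvar 3)) <| graphRel (.pair f g) (tvar 0) (tvar 3)
  | .comp f g =>
    conj (graphClauses f) <| conj (graphClauses g) <|
    imp (graphRel g (tvar 0) (tvar 1)) <| imp (graphRel f (tvar 1) (tvar 2)) <|
    graphRel (.comp f g) (tvar 0) (tvar 2)
  | .prec f g =>
    conj (graphClauses f) <| conj (graphClauses g) <|
    conj
      (imp (graphRel f (tvar 0) (tvar 1)) <| imp (terRel 1 (tvar 0) 0 (tvar 2)) <|
        graphRel (.prec f g) (tvar 2) (tvar 1))
      (imp (terRel 1 (tvar 0) (tvar 1) (tvar 2)) <|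
        imp (graphRel (.prec f g) (tvar 2) (tvar 3)) <|
        imp (terRel 1 (tvar 1) (tvar 3) (tvar 4)) <| imp (terRel 1 (tvar 0) (tvar 4) (tvar 5)) <|
        imp (graphRel g (tvar 5) (tvar 6)) <| imp (terRel 1 (tvar 0) (tvar 1 + 1) (tvar 7)) <|
        graphRel (.prec f g) (tvar 7) (tvar 6))
  | .rfind' f =>
    conj (graphClauses f) <|
    -- The search at `pair a m` stops with `m` if `f` vanishes there; otherwise it has the same
    -- value as the search at `pair a (m + 1)`. A successor term expresses "nonzero" without
    -- negation.
    conj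
      (imp (terRel 1 (tvar 0) (tvar 1) (tvar 2)) <| imp (graphRel f (tvar 2) 0) <|
        graphRel (.rfind' f) (tvar 2) (tvar 1))
      (imp (terRel 1 (tvar 0) (tvar 1) (tvar 2)) <| imp (graphRel f (tvar 2) (tvar 3 + 1)) <|
        imp (terRel 1 (tvar 0) (tvar 1 + 1) (tvar 4)) <|
        imp (graphRel (.rfind' f) (tvar 4) (tvar 5)) <|
        graphRel (.rfind' f) (tvar 2) (tvar 5))

theorem isQuantifierFree_conj {φ ψ : SOFormula} (hφ : φ.IsQuantifierFree)
    (hψ : ψ.IsQuantifierFree) : (conj φ ψ).IsQuantifierFree :=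
  ⟨⟨hφ, hψ, trivial⟩, trivial⟩

theorem isQuantifierFree_pairingClauses : pairingClauses.IsQuantifierFree := by
  simp [pairingClauses, conj, neg, IsQuantifierFree, terRel]

theorem isQuantifierFree_graphClauses (c : Code) : (graphClauses c).IsQuantifierFree := by
  induction c <;>
    simp_all [graphClauses, conj, neg, IsQuantifierFree, terRel, graphRel, binRel]

/-- The search starts at `m` and returns the point `n + m` reached, not the offset `n`. -/
theorem mem_eval_rfind' {f : Code} {a m z : ℕ} :
    z ∈ f.rfind'.eval (Nat.pair a m) ↔ ∃ n, z = n + m ∧ 0 ∈ f.eval (Nat.pair a (n + m)) ∧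
      ∀ j < n, ∃ k, k + 1 ∈ f.eval (Nat.pair a (j + m)) := by
  have hz (b : Bool) (j : ℕ) :
      b ∈ (fun k => decide (k = 0)) <$> f.eval (Nat.pair a (j + m)) ↔
        ∃ k ∈ f.eval (Nat.pair a (j + m)), decide (k = 0) = b := Part.mem_map_iff _
  simp only [Code.eval, Nat.unpaired, Nat.unpair_pair]
  refine (Part.mem_map_iff _).trans ⟨?_, ?_⟩
  · rintro ⟨n, hn, rfl⟩
    obtain ⟨h₀, h⟩ := Nat.mem_rfind.1 hn
    refine ⟨n, rfl, by simpa using (hz _ _).1 h₀, fun j hj => ?_⟩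
    obtain ⟨k, hk, hk0⟩ := (hz _ _).1 (h hj)
    obtain ⟨k, rfl⟩ := Nat.exists_eq_succ_of_ne_zero (of_decide_eq_false hk0)
    exact ⟨k, hk⟩
  · rintro ⟨n, rfl, h₀, h⟩
    refine ⟨n, Nat.mem_rfind.2 ⟨(hz _ _).2 ⟨0, h₀, rfl⟩, fun {j} hj => ?_⟩, rfl⟩
    obtain ⟨k, hk⟩ := h j hj
    exact (hz _ _).2 ⟨k + 1, hk, rfl⟩

theorem mem_eval_pair {f g : Code} {n m : ℕ} :
    m ∈ (Code.pair f g).eval n ↔ ∃ a ∈ f.eval n, ∃ b ∈ g.eval n, Nat.pair a b = m := by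
  simp [Code.eval, Seq.seq, eq_comm]

theorem mem_eval_comp {f g : Code} {n m : ℕ} :
    m ∈ (Code.comp f g).eval n ↔ ∃ a ∈ g.eval n, m ∈ f.eval a :=
  Part.mem_bind_iff

theorem mem_eval_prec_succ {f g : Code} {a k m : ℕ} :
    m ∈ (Code.prec f g).eval (Nat.pair a (k + 1)) ↔
      ∃ i ∈ (Code.prec f g).eval (Nat.pair a k), m ∈ g.eval (Nat.pair a (Nat.pair k i)) := by
  rw [Code.eval_prec_succ]
  simp

/-- The intended interpretation of the relation variables in `ℕ`. -/
def intended (R : RelVar) (args : Fin R.arity → ℕ) : Prop :=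
  match List.ofFn args with
  | [a, b] => b ∈ (Denumerable.ofNat Code R.index).eval a
  | [a, b, c] => if R.index = 0 then a * b = c else Nat.pair a b = c
  | _ => False

theorem bin_intended {c : Code} {a b : ℕ} :
    bin intended (Encodable.encode c) a b ↔ b ∈ c.eval a := by
  change b ∈ (Denumerable.ofNat Code (Encodable.encode c)).eval a ↔ _
  rw [Denumerable.ofNat_encode]

theorem ter_intended_zero {a b c : ℕ} : ter intended 0 a b c ↔ a * b = c := Iff.rfl

theorem ter_intended_one {a b c : ℕ} : ter intended 1 a b c ↔ Nat.pair a b = c := Iff.rfl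

theorem sat_pairingClauses_intended (v : ℕ → ℕ) : pairingClauses.Sat v intended := by
  simp only [pairingClauses, sat_conj, sat_imp, sat_terRel, ter_intended_zero, ter_intended_one,
    presburger.realize_zero, presburger.realize_one, presburger.realize_add, realize_tvar]
  refine ⟨by simp, fun h => by rw [← h]; ring, fun h => ?_, fun h => ?_⟩
  · rw [Nat.pair, if_pos (by omega), h]
  · rw [Nat.pair, if_neg (by omega), h]

theorem sat_graphClauses_intended (c : Code) (v : ℕ → ℕ) : (graphClauses c).Sat v intended := by
  induction c <;>
    simp only [graphClauses, graphRel, sat_conj, sat_imp, sat_terRel, sat_binRel, bin_intended,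
      ter_intended_one, presburger.realize_zero, presburger.realize_one, presburger.realize_add,
      realize_tvar]
  case zero => simp [Code.eval, pure, PFun.pure]
  case succ => simp [Code.eval]
  case left => intro h; simp [Code.eval, ← h]
  case right => intro h; simp [Code.eval, ← h]
  case pair f g hf hg => exact ⟨hf, hg, fun h₁ h₂ h₃ => mem_eval_pair.2 ⟨_, h₁, _, h₂, h₃⟩⟩
  case comp f g hf hg => exact ⟨hf, hg, fun h₁ h₂ => mem_eval_comp.2 ⟨_, h₁, h₂⟩⟩
  case prec f g hf hg =>
    refine ⟨hf, hg, fun h₁ h₂ => ?_, fun h₁ h₂ h₃ h₄ h₅ h₆ => ?_⟩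
    · rwa [← h₂, Code.eval_prec_zero]
    · rw [← h₆]
      exact mem_eval_prec_succ.2 ⟨_, by rwa [h₁], by rwa [h₃, h₄]⟩
  case rfind' f hf =>
    refine ⟨hf, fun h₁ h₂ => ?_, fun h₁ h₂ h₃ h₄ => ?_⟩
    · rw [← h₁]
      exact mem_eval_rfind'.2 ⟨0, by simp, by simpa [h₁] using h₂, by simp⟩
    · rw [← h₃] at h₄
      obtain ⟨n, hn, h₀, h⟩ := mem_eval_rfind'.1 h₄
      rw [← h₁]
      refine mem_eval_rfind'.2 ⟨n + 1, by omega, ?_, fun j hj => ?_⟩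
      · rwa [Nat.add_assoc, Nat.add_comm 1]
      -- The clause's own premise covers the starting point; the search begun one later covers the
      -- rest.
      · rcases j with _ | j
        · exact ⟨v 3, by rwa [Nat.zero_add, h₁]⟩
        · obtain ⟨k, hk⟩ := h j (by omega)
          exact ⟨k, by rwa [Nat.add_assoc, Nat.add_comm 1]⟩

/-! ### Solutions of the clauses contain the true graphs -/

theorem ter_pair_of_sat {ρ : (R : RelVar) → (Fin R.arity → ℕ) → Prop}
    (h : ∀ v : ℕ → ℕ, pairingClauses.Sat v ρ) (a b : ℕ) : ter ρ 1 a b (Nat.pair a b) := by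
  simp only [pairingClauses, sat_conj, sat_imp, sat_terRel, forall_and,
    presburger.realize_zero, presburger.realize_one, presburger.realize_add, realize_tvar] at h
  obtain ⟨h₁, h₂, h₃, h₄⟩ := h
  have mul : ∀ x y, ter ρ 0 x y (x * y) := by
    intro x y
    induction y with
    | zero => exact h₁ fun _ => x
    -- The list gives the values of variables 0, 1, 2; the default 0 is never read.
    | succ y ih => exact h₂ (fun i => [x, y, x * y].getD i 0) ih
  rcases lt_or_ge a b with hab | hab
  · obtain ⟨d, rfl⟩ := Nat.exists_eq_add_of_lt hab
    rw [Nat.pair, if_pos hab]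
    exact h₃ (fun i => [a, d, (a + d + 1) * (a + d + 1)].getD i 0) (mul _ _)
  · obtain ⟨d, rfl⟩ := Nat.exists_eq_add_of_le hab
    rw [Nat.pair, if_neg (by omega)]
    exact h₄ (fun i => [b, d, (b + d) * (b + d)].getD i 0) (mul _ _)

/-- Every halting computation unwinds into a finite derivation from the clauses. Extra pairs in `ρ`
are allowed, so only this inclusion can be expected. -/
theorem bin_graph_of_sat {ρ : (R : RelVar) → (Fin R.arity → ℕ) → Prop}
    (hρ : ∀ a b, ter ρ 1 a b (Nat.pair a b)) {c : Code}
    (h : ∀ v : ℕ → ℕ, (graphClauses c).Sat v ρ) {n m : ℕ} (hm : m ∈ c.eval n) :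
    bin ρ (Encodable.encode c) n m := by
  induction c generalizing n m <;>
    simp only [graphClauses, graphRel, sat_conj, sat_imp, sat_terRel, sat_binRel, forall_and,
      presburger.realize_zero, presburger.realize_one, presburger.realize_add, realize_tvar] at h
  case zero =>
    obtain rfl : m = 0 := by simpa [Code.eval, pure, PFun.pure] using hm
    exact h fun _ => n
  case succ =>
    obtain rfl : m = n + 1 := by simpa [Code.eval] using hm
    exact h fun _ => n
  case left =>
    obtain rfl : m = n.unpair.1 := by simpa [Code.eval] using hm
    refine h (fun i => [n.unpair.1, n.unpair.2, n].getD i 0) ?_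
    simpa using hρ n.unpair.1 n.unpair.2
  case right =>
    obtain rfl : m = n.unpair.2 := by simpa [Code.eval] using hm
    refine h (fun i => [n.unpair.1, n.unpair.2, n].getD i 0) ?_
    simpa using hρ n.unpair.1 n.unpair.2
  case pair f g hf hg =>
    obtain ⟨a, ha, b, hb, rfl⟩ := mem_eval_pair.1 hm
    exact h.2.2 (fun i => [n, a, b, Nat.pair a b].getD i 0) (hf h.1 ha) (hg h.2.1 hb) (hρ a b)
  case comp f g hf hg =>
    obtain ⟨a, ha, hb⟩ := mem_eval_comp.1 hm
    exact h.2.2 (fun i => [n, a, m].getD i 0) (hg h.2.1 ha) (hf h.1 hb)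
  case prec f g hf hg =>
    obtain ⟨h₁, h₂, h₃, h₄⟩ := h
    obtain ⟨a, k, rfl⟩ : ∃ a k, n = Nat.pair a k := ⟨_, _, (Nat.pair_unpair n).symm⟩
    induction k generalizing m with
    | zero =>
      rw [Code.eval_prec_zero] at hm
      exact h₃ (fun i => [a, m, Nat.pair a 0].getD i 0) (hf h₁ hm) (hρ a 0)
    | succ k ih =>
      obtain ⟨i, hi, hm⟩ := mem_eval_prec_succ.1 hm
      exact h₄ (fun j => [a, k, Nat.pair a k, i, Nat.pair k i, Nat.pair a (Nat.pair k i), m,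
        Nat.pair a (k + 1)].getD j 0) (hρ _ _) (ih hi) (hρ _ _) (hρ _ _) (hg h₂ hm) (hρ _ _)
  case rfind' f hf =>
    obtain ⟨h₁, h₂, h₃⟩ := h
    obtain ⟨a, k, rfl⟩ : ∃ a k, n = Nat.pair a k := ⟨_, _, (Nat.pair_unpair n).symm⟩
    obtain ⟨n, rfl, h₀, hj⟩ := mem_eval_rfind'.1 hm
    clear hm
    -- Induction on the length of the search; the starting point `k` must vary because the clause
    -- moves it to `k + 1`.
    induction n generalizing k with
    | zero =>
      rw [Nat.zero_add] at h₀ ⊢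
      exact h₂ (fun i => [a, k, Nat.pair a k].getD i 0) (hρ _ _) (hf h₁ h₀)
    | succ n ih =>
      have hnk : n + 1 + k = n + (k + 1) := by omega
      obtain ⟨l, hl⟩ := hj 0 n.succ_pos
      rw [Nat.zero_add] at hl
      rw [hnk] at h₀ ⊢
      refine h₃ (fun i => [a, k, Nat.pair a k, l, Nat.pair a (k + 1), n + (k + 1)].getD i 0)
        (hρ _ _) (hf h₁ hl) (hρ _ _) (ih (k + 1) h₀ fun j hjn => ?_)
      obtain ⟨l, hl⟩ := hj (j + 1) (by omega)
      exact ⟨l, by rwa [show j + (k + 1) = j + 1 + k by omega]⟩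

/-! ### The reduction -/

/-- The matrix of the sentence saying that the function with code `c` is undefined at `n`. -/
def undefinedMatrix (c : Code) (n : ℕ) : SOFormula :=
  conj (conj pairingClauses (graphClauses c))
    -- The input enters only through this one equation.
    (imp (eq (tvar 0) n) (imp (graphRel c (tvar 0) (tvar 1)) falsum))

theorem isQuantifierFree_undefinedMatrix (c : Code) (n : ℕ) :
    (undefinedMatrix c n).IsQuantifierFree :=
  isQuantifierFree_conj
    (isQuantifierFree_conj isQuantifierFree_pairingClauses (isQuantifierFree_graphClauses c))
    ⟨trivial, trivial, trivial⟩

theorem exists_forall_sat_undefinedMatrix_iff {c : Code} {n : ℕ} :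
    (∃ ρ : (R : RelVar) → (Fin R.arity → ℕ) → Prop,
      ∀ v : ℕ → ℕ, (undefinedMatrix c n).Sat v ρ) ↔ ¬ (c.eval n).Dom := by
  simp only [undefinedMatrix, sat_conj, sat_imp, forall_and, graphRel, sat_binRel, realize_tvar]
  constructor
  · rintro ⟨ρ, ⟨hp, hg⟩, h⟩ hd
    obtain ⟨m, hm⟩ := Part.dom_iff_mem.1 hd
    refine h (fun i => [n, m].getD i 0) ?_ (bin_graph_of_sat (ter_pair_of_sat hp) hg hm)
    simp [Sat, realize_tvar]
  · intro hd
    refine ⟨intended, ⟨sat_pairingClauses_intended, sat_graphClauses_intended c⟩, ?_⟩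
    intro v hv h
    have hv : v 0 = n := by simpa [Sat, realize_tvar] using hv
    rw [bin_intended, hv] at h
    exact hd (Part.dom_iff_mem.2 ⟨_, h⟩)

theorem varFinset_natCast (n : ℕ) : (n : presburger.Term ℕ).varFinset = ∅ := by
  induction n with
  | zero =>
    refine Finset.eq_empty_of_forall_notMem fun x hx => ?_
    obtain ⟨i, -⟩ := (Finset.mem_biUnion.1 hx)
    exact i.elim0
  | succ n ih =>
    refine Finset.eq_empty_of_forall_notMem fun x hx => ?_
    obtain ⟨i, -, hi⟩ := (Finset.mem_biUnion.1 hx)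
    fin_cases i
    · exact Finset.notMem_empty x (ih ▸ hi)
    · obtain ⟨i, -⟩ := (Finset.mem_biUnion.1 hi)
      exact i.elim0

theorem freeVars_undefinedMatrix (c : Code) (n : ℕ) :
    (undefinedMatrix c n).freeVars = (undefinedMatrix c 0).freeVars := by
  simp only [undefinedMatrix, conj, neg, freeVars, varFinset_natCast]

theorem freeRelVars_undefinedMatrix (c : Code) (n : ℕ) :
    (undefinedMatrix c n).freeRelVars = (undefinedMatrix c 0).freeRelVars := rfl

/-- The sentence saying that the function with code `c` is undefined at `n`. -/
noncomputable def undefinedSentence (c : Code) (n : ℕ) : SOFormula :=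
  -- Taking the prefix from the matrix at input 0 makes it visibly independent of `n`; numerals are
  -- closed, so it still binds everything.
  exRels (finite_freeRelVars (undefinedMatrix c 0)).toFinset.toList <|
    alls (finite_freeVars (undefinedMatrix c 0)).toFinset.toList <| undefinedMatrix c n

theorem undefinedSentence_mem (c : Code) (n : ℕ) : undefinedSentence c n ∈ existsRelForall := by
  refine ⟨⟨?_, ?_⟩, [], _, _, _, isQuantifierFree_undefinedMatrix c n, rfl⟩
  · rw [undefinedSentence, freeVars_exRels, freeVars_alls, freeVars_undefinedMatrix]
    simp
  · rw [undefinedSentence, freeRelVars_exRels, freeRelVars_alls, freeRelVars_undefinedMatrix]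
    simp

theorem satisfiableModulo_undefinedSentence {c : Code} {n : ℕ} :
    SatisfiableModulo presburgerTheory (undefinedSentence c n) ↔ ¬ (c.eval n).Dom := by
  rw [← exists_forall_sat_undefinedMatrix_iff]
  refine satisfiableModulo_iff_nat (isQuantifierFree_undefinedMatrix c n) ?_
  rw [freeVars_undefinedMatrix]
  simp

/-! ### Computability of the reduction -/

theorem computable_code_imp {φ ψ : ℕ → SOFormula} (hφ : Computable fun n => (φ n).code)
    (hψ : Computable fun n => (ψ n).code) : Computable fun n => (imp (φ n) (ψ n)).code :=
  Primrec₂.natPair.to_comp.comp (Computable.const 1) (Primrec₂.natPair.to_comp.comp hφ hψ)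

theorem computable_code_neg {φ : ℕ → SOFormula} (hφ : Computable fun n => (φ n).code) :
    Computable fun n => (neg (φ n)).code :=
  computable_code_imp hφ (Computable.const _)

theorem computable_code_conj {φ ψ : ℕ → SOFormula} (hφ : Computable fun n => (φ n).code)
    (hψ : Computable fun n => (ψ n).code) : Computable fun n => (conj (φ n) (ψ n)).code :=
  computable_code_neg (computable_code_imp hφ (computable_code_neg hψ))

theorem computable_code_alls (ys : List ℕ) {φ : ℕ → SOFormula}
    (hφ : Computable fun n => (φ n).code) : Computable fun n => (alls ys (φ n)).code := by
  induction ys with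
  | nil => exact hφ
  | cons y ys ih =>
    exact computable_code_neg (φ := fun n => ex y (neg (alls ys (φ n))))
      (Primrec₂.natPair.to_comp.comp (Computable.const 4)
        (Primrec₂.natPair.to_comp.comp (Computable.const y) (computable_code_neg ih)))

theorem computable_code_exRels (Rs : List RelVar) {φ : ℕ → SOFormula}
    (hφ : Computable fun n => (φ n).code) : Computable fun n => (exRels Rs (φ n)).code := by
  induction Rs with
  | nil => exact hφ
  | cons R Rs ih =>
    exact Primrec₂.natPair.to_comp.comp (Computable.const 5)
      (Primrec₂.natPair.to_comp.comp (Computable.const R.code) ih)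

/-- The numeral `n + 1` is the sum of the numeral `n` and the constant 1, so the codes obey a
primitive recursion. -/
theorem computable_termCode_natCast :
    Computable fun n : ℕ => termCode (n : presburger.Term ℕ) := by
  have h : Primrec fun n : ℕ => Nat.rec (motive := fun _ => ℕ) (Nat.pair 1 0)
      (fun _ k => Nat.pair 3 (Nat.pair k (Nat.pair 2 0))) n :=
    Primrec.nat_rec₁ _ (Primrec₂.natPair.comp (Primrec.const 3)
      (Primrec₂.natPair.comp Primrec.snd (Primrec.const _)))
  refine h.to_comp.of_eq fun n => ?_
  induction n with
  | zero => rfl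
  | succ n ih => exact congrArg (fun k => Nat.pair 3 (Nat.pair k (Nat.pair 2 0))) ih

theorem computable_code_undefinedSentence (c : Code) :
    Computable fun n => (undefinedSentence c n).code := by
  refine computable_code_exRels _ (computable_code_alls _ (computable_code_conj
    (Computable.const _) (computable_code_imp ?_ (Computable.const _))))
  exact Primrec₂.natPair.to_comp.comp (Computable.const 2)
    (Primrec₂.natPair.to_comp.comp (Computable.const _) computable_termCode_natCast)

end SOFormula

/-! ### Undecidability from the halting problem -/

theorem theorem3 :
    ¬ AlgorithmicallyDecidable SOFormula.existsRelForall
      (SOFormula.SatisfiableModulo presburgerTheory) := by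
  rintro ⟨f, hf, hdec⟩
  -- The universal code `u` runs the program coded by its input on 0.
  obtain ⟨u, hu⟩ := Code.exists_code.1 (Partrec.nat_iff.1
    (Code.eval_part.comp (Computable.ofNat Code) (Computable.const 0)))
  have hu : ∀ c : Code, u.eval (Encodable.encode c) = c.eval 0 := fun c =>
    (congrFun hu _).trans (by simp)
  classical
  refine ComputablePred.halting_problem 0 (ComputablePred.of_eq (ComputablePred.not
    ⟨inferInstance, ?_⟩) fun c => not_not (a := (c.eval 0).Dom))
  -- `f` may diverge outside the class, but the reduction stays inside it, so the composite is total
  -- and decides non-halting at 0.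
  refine (hf.comp ((SOFormula.computable_code_undefinedSentence u).comp
    Computable.encode)).of_eq fun c => ?_
  obtain ⟨b, hb, h⟩ := hdec _ (SOFormula.undefinedSentence_mem u (Encodable.encode c))
  rw [SOFormula.satisfiableModulo_undefinedSentence, hu] at h
  obtain rfl : b = decide ¬ (c.eval 0).Dom := by rw [Bool.eq_iff_iff, h, decide_eq_true_iff]
  exact Part.eq_some_iff.2 hb
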